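/- For a nonnegative integer $k$ let $H_k=\sum_{j=1}^{k}\frac1j$ (so $H_0=0$), and for a nonnegative integer $n$ and an integer $u\neq 0$ put \[T_n^{(u)}=\sum_{k=0}^n\binom{n}{k}^{u}\bigl\{1+u(n-2k)H_k\bigr\}.\] Then for all nonnegative integers $m$ and $n$, \[T_n^{(2m+4)}=(-1)^n\sum_{0\le i_1\le i_2\le\cdots\le i_m\le n}\binom{n+i_1}{n}\prod_{r=1}^{m}\binom{n}{i_r}^2\binom{n+i_{r+1}-i_r}{n},\] where $i_1,\dots,i_m$ are integers and $i_{m+1}=n$ (for $m=0$ the right-hand side is its single term $(-1)^n\binom{2n}{n}$, since then $i_1=n$). In particular, for all nonnegative integers $n$, \[T_n^{(8)}=(-1)^n\sum_{i=0}^n\binom{n}{i}^2\binom{2n-i}{n}\sum_{j=0}^i\binom{n}{j}^2\binom{n+j}{n}\binom{n+i-j}{n}\] and \[T_n^{(10)}=(-1)^n\sum_{i=0}^n\binom{n}{i}^2\binom{2n-i}{n}\sum_{j=0}^i\binom{n}{j}^2\binom{n+i-j}{n}\sum_{t=0}^j\binom{n}{t}^2\binom{n+t}{n}\binom{n+j-t}{n}.\]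 -/

import Mathlib

/-- The sum `T_n^{(u)} = ∑_{k=0}^n C(n,k)^u (1 + u (n - 2k) H_k)` for an integer exponent `u`
(only used for `u ≠ 0`), where `H_k = 1 + 1/2 + ⋯ + 1/k` is Mathlib's `harmonic k`. -/
def harmonicT (u : ℤ) (n : ℕ) : ℚ :=
  ∑ k ∈ Finset.range (n + 1),
    (n.choose k : ℚ) ^ u * (1 + (u : ℚ) * ((n : ℚ) - 2 * (k : ℚ)) * harmonic k)

/-- The tuples `(i_1, …, i_m, i_{m+1})` of integers with
`0 ≤ i_1 ≤ i_2 ≤ ⋯ ≤ i_m ≤ i_{m+1} = n`. The entry `i_{r+1}` is the value at `r : Fin (m + 1)`. -/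
def chainsTo (m n : ℕ) : Finset (Fin (m + 1) → Fin (n + 1)) :=
  {i | (∀ r : Fin m, i r.castSucc ≤ i r.succ) ∧ i (Fin.last m) = Fin.last n}

/-!
Write `(a)_r` for the rising factorial, `c_r = (a)_r / r!` and `d_k = (1 - a)_k / k!`. The sum
`T_n^{(2m+4)}` is the derivative at `x = 0` of a terminating very-well-poised series with
`a = x - n`,
`∑_r (-1)^r (a + 2r) c_r^{2m+3} C(n, r) r! / (1 + x)_r`.
Indeed each of the `2m + 4` factors `c_r`, `r! / (1 + x)_r` reduces to `± C(n, r)` at `x = 0`; its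
logarithmic derivative is a combination of `H_n`, `H_{n-r}` and `H_r`, and reversing the summation
replaces it by `-H_r` in a sum against `C(n, r)^{2m+4} (2r - n)`. The factor `a + 2r` has derivative
`1` and accounts for the `1` in `1 + u (n - 2k) H_k` (`hasDerivAt_sum_wellPoised`).

For generic `a` the series is evaluated by the Bailey chain. If
`B_i = i!² ∑_r α_r / ((i - r)! (1 + a)_{i+r})`, then passing from `α_r` to `c_r² α_r` passes from `B`
to `B'_i = ∑_{j ≤ i} c_j² d_{i-j} B_j` (`baileyStep_baileySum`); after an exchange of sums this is the
Pfaff–Saalschütz summation (`saalschutz`). Starting from the unit pair (`baileySum_unitAlpha`) and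
taking `i = n`, the series becomes `x` times a quantity continuous in `x` (`sum_wellPoised`), where
the factor `x` comes from `(x - n)_{n+1}`. The derivative at `0` is therefore the value of that
quantity at `x = 0`, where `c_j² = C(n, j)²` and `d_k = C(n + k, n)`
(`harmonicT_eq_baileyChain`). Unrolling the recursion for `B` gives the sum over chains
`i_1 ≤ ⋯ ≤ i_m ≤ n` (`sum_chain_eq_baileyChain`).
-/

open Finset

/-! ### Rising factorials and the Pfaff–Saalschütz summation -/

section Pochhammer

variable {K : Type*} [Field K]

/-- The rising factorial `(a)_k = a (a + 1) ⋯ (a + k - 1)`. -/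
noncomputable def risingFactorial (a : K) (k : ℕ) : K := (ascPochhammer K k).eval a

/-- The coefficient `(a)_k / k!` of `z ^ k` in `(1 - z) ^ (-a)`. -/
noncomputable def risingCoeff (a : K) (k : ℕ) : K := risingFactorial a k / (k.factorial : K)

@[simp] lemma risingFactorial_zero (a : K) : risingFactorial a 0 = 1 := by
  simp [risingFactorial]

lemma risingFactorial_succ (a : K) (k : ℕ) :
    risingFactorial a (k + 1) = risingFactorial a k * (a + k) :=
  ascPochhammer_succ_eval k a

lemma risingFactorial_add (a : K) (k l : ℕ) :
    risingFactorial a (k + l) = risingFactorial a k * risingFactorial (a + k) l := by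
  induction l with
  | zero => simp
  | succ l ih =>
    rw [← add_assoc, risingFactorial_succ, ih, risingFactorial_succ]
    push_cast
    ring

lemma risingFactorial_ne_zero {a : K} {k : ℕ} (h : ∀ j < k, a + (j : K) ≠ 0) :
    risingFactorial a k ≠ 0 := by
  induction k with
  | zero => simp
  | succ k ih =>
    rw [risingFactorial_succ]
    exact mul_ne_zero (ih fun j hj => h j (hj.trans k.lt_succ_self)) (h k k.lt_succ_self)

lemma factorial_mul_risingFactorial (r k : ℕ) :
    (r.factorial : K) * risingFactorial ((r : K) + 1) k = ((r + k).factorial : K) := by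
  induction k with
  | zero => simp
  | succ k ih =>
    rw [risingFactorial_succ, ← mul_assoc, ih, ← add_assoc, Nat.factorial_succ]
    push_cast
    ring

@[simp] lemma risingCoeff_zero (a : K) : risingCoeff a 0 = 1 := by
  simp [risingCoeff]

lemma risingCoeff_succ (a : K) (k : ℕ) :
    risingCoeff a (k + 1) = risingCoeff a k * ((a + k) / ((k : K) + 1)) := by
  rw [risingCoeff, risingCoeff, risingFactorial_succ, Nat.factorial_succ, div_mul_div_comm]
  push_cast
  rw [mul_comm (k.factorial : K)]

/-- The partial sums that make the induction step of the Pfaff–Saalschütz summation telescope. -/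
lemma saalschutz_partial_sum [CharZero K] (p q c : K) (N : ℕ)
    (hc : ∀ k < N, c + (k : K) ≠ 0) (M : ℕ) (hM : M ≤ N) :
    ∑ s ∈ range (M + 1),
      ((c + N) * ((N + 1).choose s * risingFactorial p s * risingFactorial q s *
          risingFactorial (c - p - q) (N + 1 - s) / risingFactorial c s) -
        (c - p + N) * (c - q + N) * (N.choose s * risingFactorial p s * risingFactorial q s *
          risingFactorial (c - p - q) (N - s) / risingFactorial c s)) =
      -(N.choose M * risingFactorial p (M + 1) * risingFactorial q (M + 1) *
          risingFactorial (c - p - q) (N - M) / risingFactorial c M) := by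
  induction M with
  | zero =>
    simp [risingFactorial_succ]
    ring
  | succ M ih =>
    obtain ⟨k, rfl⟩ : ∃ k, N = M + 1 + k := ⟨N - (M + 1), by omega⟩
    rw [sum_range_succ, ih (by omega)]
    have h1 : M + 1 + k - M = k + 1 := by omega
    have h2 : M + 1 + k + 1 - (M + 1) = k + 1 := by omega
    have h3 : M + 1 + k - (M + 1) = k := by omega
    have hA : ((M + 1 + k).choose (M + 1) : K) * (M + 1) = (M + 1 + k).choose M * (k + 1) := by
      have := Nat.choose_succ_right_eq (M + 1 + k) M
      rw [h1] at this
      exact_mod_cast this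
    have hM0 : c + (M : K) ≠ 0 := hc M (by omega)
    have hcM : risingFactorial c M ≠ 0 :=
      risingFactorial_ne_zero fun j hj => hc j (by omega)
    rw [h1, h2, h3, Nat.choose_succ_succ, risingFactorial_succ p (M + 1),
      risingFactorial_succ q (M + 1), risingFactorial_succ p M, risingFactorial_succ q M,
      risingFactorial_succ c M, risingFactorial_succ _ k]
    push_cast
    generalize ((M + 1 + k).choose M : K) = A at *
    generalize ((M + 1 + k).choose (M + 1) : K) = B at *
    field_simp
    linear_combination (-(c - p - q + k)) * risingFactorial p M * (p + M) *
      risingFactorial q M * (q + M) * risingFactorial (c - p - q) k * hA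

/-- The Pfaff–Saalschütz summation of a terminating balanced `₃F₂(1)`. -/
lemma saalschutz [CharZero K] (p q c : K) (N : ℕ) (hc : ∀ k < N, c + (k : K) ≠ 0) :
    ∑ s ∈ range (N + 1), (N.choose s * risingFactorial p s * risingFactorial q s *
        risingFactorial (c - p - q) (N - s) / risingFactorial c s) =
      risingFactorial (c - p) N * risingFactorial (c - q) N / risingFactorial c N := by
  induction N with
  | zero => simp
  | succ N ih =>
    have hc' : ∀ k < N, c + (k : K) ≠ 0 := fun k hk => hc k (by omega)
    have hN : c + (N : K) ≠ 0 := hc N (by omega)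
    have hcN : risingFactorial c N ≠ 0 := risingFactorial_ne_zero hc'
    have key := saalschutz_partial_sum p q c N hc' N le_rfl
    rw [sum_sub_distrib, ← mul_sum, ← mul_sum, ih hc'] at key
    simp only [Nat.choose_self, Nat.sub_self, risingFactorial_zero, Nat.cast_one, one_mul,
      mul_one] at key
    refine mul_left_cancel₀ hN ?_
    rw [sum_range_succ, mul_add, sub_eq_iff_eq_add.mp key]
    simp only [Nat.choose_self, Nat.sub_self, risingFactorial_zero, Nat.cast_one, one_mul,
      mul_one, risingFactorial_succ]
    field_simp
    ring

end Pochhammer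

/-! ### The Bailey chain -/

section Bailey

variable {K : Type*} [Field K]

/-- The operator `B ↦ B'`, `B'_i = ∑_{j ≤ i} ((a)_j / j!)² ((1 - a)_{i-j} / (i-j)!) B_j`: the step
along the Bailey chain with both parameters equal to `a`, in terms of `B_i = i!² β_i`. -/
noncomputable def baileyStep (a : K) (B : ℕ → K) (i : ℕ) : K :=
  ∑ j ∈ range (i + 1), risingCoeff a j ^ 2 * risingCoeff (1 - a) (i - j) * B j

/-- The sequence `i!² β_i`, where `(α, β)` is the Bailey pair relative to `a` with the given `α`. -/
noncomputable def baileySum (a : K) (α : ℕ → K) (i : ℕ) : K :=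
  (i.factorial : K) ^ 2 * ∑ r ∈ range (i + 1),
    α r / (((i - r).factorial : K) * risingFactorial (1 + a) (i + r))

/-- The coefficient of `α_r` in Bailey's lemma at `i = r + N`, with the outer index `j = r + s`. -/
lemma baileyStep_baileySum_kernel [CharZero K] (a : K) (r N : ℕ)
    (ha : ∀ k < 2 * (r + N), 1 + a + (k : K) ≠ 0) :
    ∑ s ∈ range (N + 1), risingCoeff a (r + s) ^ 2 * risingCoeff (1 - a) (N - s) *
        (((r + s).factorial : K) ^ 2 / ((s.factorial : K) * risingFactorial (1 + a) (r + s + r))) =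
      ((r + N).factorial : K) ^ 2 * (risingCoeff a r ^ 2 /
        ((N.factorial : K) * risingFactorial (1 + a) (r + N + r))) := by
  have hc : ∀ k < N, (1 + a + ((r + r : ℕ) : K)) + (k : K) ≠ 0 := fun k hk => by
    have := ha (r + r + k) (by omega)
    push_cast at this ⊢
    rwa [← add_assoc] at this
  have key := saalschutz (a + r) (a + r) (1 + a + ((r + r : ℕ) : K)) N hc
  have e1 : 1 + a + ((r + r : ℕ) : K) - (a + r) = (r : K) + 1 := by push_cast; ring
  have e2 : (r : K) + 1 - (a + r) = 1 - a := by ring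
  have hfac (k : ℕ) : (k.factorial : K) ≠ 0 := Nat.cast_ne_zero.mpr k.factorial_ne_zero
  have h2r : risingFactorial (1 + a) (r + r) ≠ 0 :=
    risingFactorial_ne_zero fun j hj => ha j (by omega)
  have hcs (s : ℕ) (hs : s ≤ N) : risingFactorial (1 + a + ((r + r : ℕ) : K)) s ≠ 0 :=
    risingFactorial_ne_zero fun j hj => hc j (by omega)
  rw [e1, e2] at key
  have lhs : ∀ s ∈ range (N + 1), risingCoeff a (r + s) ^ 2 * risingCoeff (1 - a) (N - s) *
        (((r + s).factorial : K) ^ 2 / ((s.factorial : K) * risingFactorial (1 + a) (r + s + r))) =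
      risingFactorial a r ^ 2 / ((N.factorial : K) * risingFactorial (1 + a) (r + r)) *
        (N.choose s * risingFactorial (a + r) s * risingFactorial (a + r) s *
        risingFactorial (1 - a) (N - s) / risingFactorial (1 + a + ((r + r : ℕ) : K)) s) := by
    intro s hs
    have hs : s ≤ N := by simpa [Nat.lt_succ_iff] using hs
    rw [risingCoeff, risingCoeff, add_right_comm r s r, risingFactorial_add a,
      risingFactorial_add (1 + a), Nat.cast_choose K hs]
    have := hcs s hs
    have := hfac s
    have := hfac N
    have := hfac (N - s)
    have := hfac (r + s)
    field_simp
  rw [sum_congr rfl lhs, ← mul_sum, key, ← factorial_mul_risingFactorial r N, risingCoeff,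
    add_right_comm r N r, risingFactorial_add (1 + a) (r + r) N]
  have := hcs N le_rfl
  have := hfac r
  have := hfac N
  field_simp

/-- Bailey's lemma. -/
lemma baileyStep_baileySum [CharZero K] (a : K) (α : ℕ → K) (i : ℕ)
    (ha : ∀ k < 2 * i, 1 + a + (k : K) ≠ 0) :
    baileyStep a (baileySum a α) i = baileySum a (fun r => risingCoeff a r ^ 2 * α r) i := by
  simp only [baileyStep, baileySum, mul_sum]
  rw [sum_comm' (t' := range (i + 1)) (s' := fun r => Ico r (i + 1))]
  · refine sum_congr rfl fun r hr => ?_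
    obtain ⟨N, rfl⟩ : ∃ N, i = r + N := ⟨i - r, by have := mem_range.mp hr; omega⟩
    rw [sum_Ico_eq_sum_range, show r + N + 1 - r = N + 1 by omega]
    have := congrArg (α r * ·) (baileyStep_baileySum_kernel a r N ha)
    simp only [mul_sum] at this
    rw [Nat.add_sub_cancel_left]
    refine Eq.trans (sum_congr rfl fun s _ => ?_) (this.trans ?_)
    · rw [Nat.add_sub_cancel_left, Nat.add_sub_add_left]
      ring
    · ring
  · intro j r
    simp only [mem_range, mem_Ico]
    omega

/-- The `α` of the unit Bailey pair, without its factor `1 / a`. -/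
noncomputable def unitAlpha (a : K) (r : ℕ) : K := (-1) ^ r * (a + 2 * r) * risingCoeff a r

/-- Closed form of the partial sums of the unit pair; it vanishes at `M = i + 1`, where
`C(i, M) = 0`. -/
lemma unitAlpha_partial_sum [CharZero K] (a : K) (i : ℕ)
    (ha : ∀ k < 2 * (i + 1), 1 + a + (k : K) ≠ 0) (M : ℕ) (hM : M ≤ i + 1) :
    ∑ r ∈ range (M + 1),
        unitAlpha a r / (((i + 1 - r).factorial : K) * risingFactorial (1 + a) (i + 1 + r)) =
      (-1) ^ M * i.choose M * risingFactorial a (M + 1) /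
        (((i + 1).factorial : K) * risingFactorial (1 + a) (i + 1 + M)) := by
  induction M with
  | zero => simp [unitAlpha, risingFactorial_succ]
  | succ M ih =>
    rw [sum_range_succ, ih (by omega), unitAlpha, risingCoeff, risingFactorial_succ a (M + 1),
      ← add_assoc, risingFactorial_succ (1 + a)]
    have hfac (k : ℕ) : (k.factorial : K) ≠ 0 := Nat.cast_ne_zero.mpr k.factorial_ne_zero
    have h1 : risingFactorial (1 + a) (i + 1 + M) ≠ 0 :=
      risingFactorial_ne_zero fun j hj => ha j (by omega)
    have h2 : 1 + a + ((i + 1 + M : ℕ) : K) ≠ 0 := ha _ (by omega)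
    have hch : ((i + 1).factorial : K) / ((M + 1).factorial * (i + 1 - (M + 1)).factorial) =
        i.choose M + i.choose (M + 1) := by
      rw [← Nat.cast_choose K hM, Nat.choose_succ_succ]
      push_cast
      rfl
    have hmul : ((i.choose M : K) + i.choose (M + 1)) * (M + 1) = (i + 1) * i.choose M := by
      have := Nat.add_one_mul_choose_eq i M
      rw [Nat.choose_succ_succ] at this
      exact_mod_cast this.symm
    have e : (1 : K) / ((M + 1).factorial * (i + 1 - (M + 1)).factorial) =
        (i.choose M + i.choose (M + 1)) / (i + 1).factorial := by
      rw [← hch]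
      have := hfac (i + 1)
      field_simp
    have e' : (-1 : K) ^ (M + 1) * (a + 2 * ((M + 1 : ℕ) : K)) *
        (risingFactorial a (M + 1) / ((M + 1).factorial : K)) /
        (((i + 1 - (M + 1)).factorial : K) *
          (risingFactorial (1 + a) (i + 1 + M) * (1 + a + ((i + 1 + M : ℕ) : K)))) =
        (-1 : K) ^ (M + 1) * (a + 2 * ((M + 1 : ℕ) : K)) * risingFactorial a (M + 1) /
        (risingFactorial (1 + a) (i + 1 + M) * (1 + a + ((i + 1 + M : ℕ) : K))) *
        ((i.choose M + i.choose (M + 1)) / (i + 1).factorial) := by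
      rw [← e]
      have := hfac (M + 1)
      have := hfac (i + 1 - (M + 1))
      field_simp
    rw [e']
    have := hfac (i + 1)
    push_cast at h2 ⊢
    field_simp
    rw [pow_succ]
    linear_combination -((-1 : K) ^ M * risingFactorial a (M + 1)) * hmul

/-- The unit Bailey pair: its `β` vanishes except at `0`. -/
lemma baileySum_unitAlpha [CharZero K] (a : K) (i : ℕ)
    (ha : ∀ k < 2 * i, 1 + a + (k : K) ≠ 0) :
    baileySum a (unitAlpha a) i = a * (Pi.single 0 1 : ℕ → K) i := by
  cases i with
  | zero => simp [baileySum, unitAlpha]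
  | succ i => simp [baileySum, unitAlpha_partial_sum a i ha (i + 1) le_rfl]

/-- The result of `m + 1` Bailey steps started from the unit pair. -/
noncomputable def baileyChain (a : K) (m : ℕ) : ℕ → K := (baileyStep a)^[m + 1] (Pi.single 0 1)

lemma baileyChain_succ (a : K) (m : ℕ) :
    baileyChain a (m + 1) = baileyStep a (baileyChain a m) :=
  Function.iterate_succ_apply' _ _ _

lemma baileyChain_zero (a : K) (i : ℕ) : baileyChain a 0 i = risingCoeff (1 - a) i := by
  simp only [baileyChain, zero_add, Function.iterate_one, baileyStep]
  rw [sum_eq_single 0 (fun j _ hj => by simp [hj]) (by simp)]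
  simp

lemma baileyStep_congr (a : K) {B C : ℕ → K} {i : ℕ} (h : ∀ j ≤ i, B j = C j) :
    baileyStep a B i = baileyStep a C i :=
  sum_congr rfl fun j hj => by rw [h j (Nat.lt_succ_iff.mp (mem_range.mp hj))]

lemma baileySum_iterate [CharZero K] (a : K) (m i : ℕ)
    (ha : ∀ k < 2 * i, 1 + a + (k : K) ≠ 0) :
    baileySum a (fun r => risingCoeff a r ^ (2 * m) * unitAlpha a r) i =
      a * (baileyStep a)^[m] (Pi.single 0 1) i := by
  induction m generalizing i with
  | zero => simpa using baileySum_unitAlpha a i ha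
  | succ m ih =>
    have h := baileyStep_baileySum a (fun r => risingCoeff a r ^ (2 * m) * unitAlpha a r) i ha
    rw [Function.iterate_succ_apply']
    trans baileyStep a (baileySum a (fun r => risingCoeff a r ^ (2 * m) * unitAlpha a r)) i
    · rw [h]
      congr 1
      ext r
      ring
    · rw [baileyStep_congr a fun j hj => ih j fun k hk => ha k (by omega)]
      simp only [baileyStep, mul_sum]
      exact sum_congr rfl fun j _ => by ring

/-- Evaluation of a terminating very-well-poised series as a multiple sum: the case `a = x - n` of
the Bailey chain at the index `n`. -/
lemma sum_wellPoised [CharZero K] (m n : ℕ) (x : K)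
    (hx : ∀ k < 2 * n + 1, x - n + (k : K) ≠ 0) :
    ∑ r ∈ range (n + 1), (-1) ^ r * (x - n + 2 * r) * risingCoeff (x - n) r ^ (2 * m + 3) *
        n.choose r * (risingCoeff (1 + x) r)⁻¹ =
      x * (risingCoeff (x - n) n * baileyChain (x - n) m n) := by
  have ha : ∀ k < 2 * n, 1 + (x - n) + (k : K) ≠ 0 := fun k hk => by
    have := hx (k + 1) (by omega)
    push_cast at this
    convert this using 1
    ring
  have h := baileySum_iterate (x - n) (m + 1) n ha
  have hfac (k : ℕ) : (k.factorial : K) ≠ 0 := Nat.cast_ne_zero.mpr k.factorial_ne_zero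
  have hn : risingFactorial (1 + (x - n)) n ≠ 0 :=
    risingFactorial_ne_zero fun j hj => ha j (by omega)
  have e : 1 + (x - n) + (n : K) = 1 + x := by ring
  have hr (r : ℕ) (h : r ≤ n) : risingFactorial (1 + x) r ≠ 0 := by
    rw [← e]
    refine risingFactorial_ne_zero fun j hj => ?_
    have := ha (n + j) (by omega)
    push_cast at this
    rwa [← add_assoc] at this
  -- `a (1 + a)_n = (a)_n (a + n)`, the last factor being `x`.
  have hpoch : (x - n) * risingFactorial (1 + (x - n)) n = risingFactorial (x - n) n * x := by
    have h1 := risingFactorial_add (x - n) 1 n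
    rw [add_comm 1 n, risingFactorial_succ] at h1
    simp [risingFactorial_succ] at h1
    rw [h1, add_comm 1]
  -- Multiplying by `(1 + a)_n / n!` turns `n!² / ((n - r)! (1 + a)_{n+r})` into
  -- `C(n, r) r! / (1 + x)_r`.
  have h' := congrArg (risingFactorial (1 + (x - n)) n / (n.factorial : K) * ·) h
  simp only [baileySum, mul_sum] at h'
  trans risingFactorial (1 + (x - n)) n / (n.factorial : K) *
    ((x - n) * (baileyStep (x - n))^[m + 1] (Pi.single 0 1) n)
  · rw [← h']
    refine sum_congr rfl fun r hr' => ?_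
    have hrn : r ≤ n := Nat.lt_succ_iff.mp (mem_range.mp hr')
    rw [risingFactorial_add _ n r, e, unitAlpha, Nat.cast_choose K hrn,
      show risingCoeff (1 + x) r = risingFactorial (1 + x) r / (r.factorial : K) from rfl]
    have := hr r hrn
    have := hfac r
    have := hfac n
    have := hfac (n - r)
    field_simp
    ring
  · rw [baileyChain, show risingCoeff (x - n) n = risingFactorial (x - n) n / n.factorial from rfl]
    linear_combination hpoch * (baileyStep (x - n))^[m + 1] (Pi.single 0 1) n / n.factorial

end Bailey

/-! ### Differentiation at `a = -n` -/

section Derivative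

lemma risingCoeff_neg_natCast {n r : ℕ} (hr : r ≤ n) :
    risingCoeff (-(n : ℚ)) r = (-1) ^ r * n.choose r := by
  induction r with
  | zero => simp
  | succ r ih =>
    rw [risingCoeff_succ, ih (by omega)]
    have h : (n.choose (r + 1) : ℚ) * (r + 1) = n.choose r * (n - r) := by
      have := Nat.choose_succ_right_eq n r
      rw [← Nat.cast_sub (by omega : r ≤ n)]
      exact_mod_cast this
    have : (r : ℚ) + 1 ≠ 0 := by positivity
    field_simp
    rw [pow_succ]
    linear_combination (-1 : ℚ) ^ r * h

lemma risingCoeff_one (r : ℕ) : risingCoeff (1 : ℚ) r = 1 := by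
  induction r with
  | zero => simp
  | succ r ih =>
    have : (r : ℚ) + 1 ≠ 0 := by positivity
    rw [risingCoeff_succ, ih, one_mul, add_comm, div_self this]

lemma risingCoeff_one_add_natCast (n k : ℕ) :
    risingCoeff (1 + (n : ℚ)) k = (n + k).choose n := by
  rw [risingCoeff, add_comm (1 : ℚ), div_eq_iff (by positivity)]
  refine mul_left_cancel₀ (Nat.cast_ne_zero.mpr n.factorial_ne_zero) ?_
  rw [factorial_mul_risingFactorial, ← Nat.add_choose_mul_factorial_mul_factorial]
  rw [Nat.choose_symm_add]
  push_cast
  ring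

/-- Since `r ≤ n`, none of the factors `x - n + k` with `k < r` vanishes at `x = 0`. -/
lemma hasDerivAt_risingCoeff {n r : ℕ} (hr : r ≤ n) :
    HasDerivAt (fun x : ℚ => risingCoeff (x - n) r)
      ((-1) ^ r * n.choose r * (harmonic (n - r) - harmonic n)) 0 := by
  induction r with
  | zero => simpa using hasDerivAt_const (0 : ℚ) (1 : ℚ)
  | succ r ih =>
    simp only [risingCoeff_succ]
    have h1 : HasDerivAt (fun x : ℚ => (x - n + r) / ((r : ℚ) + 1)) (1 / ((r : ℚ) + 1)) 0 :=
      (((hasDerivAt_id (0 : ℚ)).sub_const _).add_const _).div_const _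
    refine ((ih (by omega)).mul h1).congr_deriv ?_
    obtain ⟨k, rfl⟩ : ∃ k, n = r + 1 + k := ⟨n - (r + 1), by omega⟩
    rw [zero_sub, risingCoeff_neg_natCast (by omega), show r + 1 + k - r = k + 1 by omega,
      show r + 1 + k - (r + 1) = k by omega, harmonic_succ]
    have h : ((r + 1 + k).choose (r + 1) : ℚ) * (r + 1) = (r + 1 + k).choose r * (k + 1) := by
      have := Nat.choose_succ_right_eq (r + 1 + k) r
      rw [show r + 1 + k - r = k + 1 by omega] at this
      exact_mod_cast this
    have h2 : (r : ℚ) + 1 ≠ 0 := by positivity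
    have h3 : (k : ℚ) + 1 ≠ 0 := by positivity
    push_cast
    field_simp
    rw [pow_succ]
    linear_combination (-1 : ℚ) ^ r * (k + 1) * (harmonic k - harmonic (r + 1 + k)) * h

lemma hasDerivAt_risingCoeff_one_add (r : ℕ) :
    HasDerivAt (fun x : ℚ => risingCoeff (1 + x) r) (harmonic r) 0 := by
  induction r with
  | zero => simpa using hasDerivAt_const (0 : ℚ) (1 : ℚ)
  | succ r ih =>
    simp only [risingCoeff_succ]
    have h1 : HasDerivAt (fun x : ℚ => (1 + x + r) / ((r : ℚ) + 1)) (1 / ((r : ℚ) + 1)) 0 :=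
      (((hasDerivAt_id (0 : ℚ)).const_add _).add_const _).div_const _
    refine (ih.mul h1).congr_deriv ?_
    rw [add_zero, risingCoeff_one, harmonic_succ]
    have h2 : (r : ℚ) + 1 ≠ 0 := by positivity
    push_cast
    field_simp
    ring

lemma continuous_risingCoeff (r : ℕ) : Continuous fun a : ℚ => risingCoeff a r :=
  (ascPochhammer ℚ r).continuous.div_const _

lemma continuous_baileyChain (m i : ℕ) : Continuous fun a : ℚ => baileyChain a m i := by
  induction m generalizing i with
  | zero =>
    simp only [baileyChain_zero]
    exact (continuous_risingCoeff i).comp (continuous_const.sub continuous_id)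
  | succ m ih =>
    simp only [baileyChain_succ, baileyStep]
    refine continuous_finsetSum _ fun j _ => ?_
    exact (((continuous_risingCoeff j).pow 2).mul
      ((continuous_risingCoeff (i - j)).comp (continuous_const.sub continuous_id))).mul (ih j)

/-- Reversal of the summation turns a factor `n - 2k` into its negative. -/
lemma sum_choose_pow_reflect (u n : ℕ) (f : ℕ → ℚ) :
    ∑ k ∈ range (n + 1), (n.choose k : ℚ) ^ u * (n - 2 * k) * f (n - k) =
      -∑ k ∈ range (n + 1), (n.choose k : ℚ) ^ u * (n - 2 * k) * f k := by
  rw [← sum_range_reflect, ← sum_neg_distrib]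
  refine sum_congr rfl fun k hk => ?_
  have hk : k ≤ n := Nat.lt_succ_iff.mp (mem_range.mp hk)
  rw [show n + 1 - 1 - k = n - k by omega, Nat.choose_symm hk, Nat.sub_sub_self hk,
    Nat.cast_sub hk]
  ring

lemma sum_choose_pow_mul_sub (u n : ℕ) :
    ∑ k ∈ range (n + 1), (n.choose k : ℚ) ^ u * (n - 2 * k) = 0 := by
  have := sum_choose_pow_reflect u n fun _ => 1
  simp only [mul_one] at this
  linarith

/-- The derivative at `x = 0` of the very-well-poised series. The parts with `H_{n-r}` and `H_n`
produced by the factors `(x - n)_r / r!` become `H_r` and `0` on reversing the summation. -/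
lemma hasDerivAt_sum_wellPoised (m n : ℕ) :
    HasDerivAt (fun x : ℚ => ∑ r ∈ range (n + 1),
      (-1) ^ r * (x - n + 2 * r) * risingCoeff (x - n) r ^ (2 * m + 3) *
        n.choose r * (risingCoeff (1 + x) r)⁻¹) (harmonicT (2 * (m : ℤ) + 4) n) 0 := by
  have hterm : ∀ r ∈ range (n + 1), HasDerivAt (fun x : ℚ =>
      (-1) ^ r * (x - n + 2 * r) * risingCoeff (x - n) r ^ (2 * m + 3) *
        n.choose r * (risingCoeff (1 + x) r)⁻¹)
      ((n.choose r : ℚ) ^ (2 * m + 4) * (1 + (n - 2 * r) *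
        ((2 * m + 3) * (harmonic n - harmonic (n - r)) + harmonic r))) 0 := by
    intro r hr
    have hr : r ≤ n := Nat.lt_succ_iff.mp (mem_range.mp hr)
    have h1 : HasDerivAt (fun x : ℚ => (-1 : ℚ) ^ r * (x - n + 2 * r)) ((-1) ^ r * 1) 0 :=
      (((hasDerivAt_id (0 : ℚ)).sub_const _).add_const _).const_mul _
    have h2 := (hasDerivAt_risingCoeff hr).pow (2 * m + 3)
    have h3 := (hasDerivAt_risingCoeff_one_add r).inv (by simp [risingCoeff_one])
    refine (((h1.mul h2).mul_const (n.choose r : ℚ)).mul h3).congr_deriv ?_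
    have hs : ((-1 : ℚ) ^ r) ^ 2 = 1 := by rw [← pow_mul, mul_comm, pow_mul]; simp
    have hsp : (-1 : ℚ) ^ r * ((-1 : ℚ) ^ r) ^ (2 * m + 3) = 1 := by
      rw [← pow_succ', show 2 * m + 3 + 1 = 2 * (m + 2) by ring, pow_mul, hs, one_pow]
    simp only [Pi.pow_apply, Pi.mul_apply, Pi.inv_apply, add_zero, zero_sub, risingCoeff_one,
      risingCoeff_neg_natCast hr, inv_one, one_pow, mul_pow,
      show 2 * m + 3 - 1 = 2 * m + 2 by omega]
    push_cast
    have e3 (t : ℚ) : t ^ (2 * m + 3) = t ^ (2 * m + 2) * t := pow_succ _ _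
    have e4 (t : ℚ) : t ^ (2 * m + 4) = t ^ (2 * m + 2) * t * t := by
      rw [pow_succ, pow_succ]
    rw [e3] at hsp
    rw [e3, e3, e4]
    linear_combination ((n.choose r : ℚ) ^ (2 * m + 2) * n.choose r * n.choose r *
      (1 + (n - 2 * r) *
        ((2 * m + 3) * (harmonic n - harmonic (n - r)) + harmonic r))) * hsp
  refine (HasDerivAt.fun_sum hterm).congr_deriv ?_
  have h1 := sum_choose_pow_mul_sub (2 * m + 4) n
  have h2 := sum_choose_pow_reflect (2 * m + 4) n harmonic
  have hT : harmonicT (2 * (m : ℤ) + 4) n = ∑ k ∈ range (n + 1),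
      (n.choose k : ℚ) ^ (2 * m + 4) * (1 + (2 * m + 4) * (n - 2 * k) * harmonic k) := by
    rw [harmonicT]
    refine sum_congr rfl fun k _ => ?_
    rw [show (2 * (m : ℤ) + 4) = ((2 * m + 4 : ℕ) : ℤ) by push_cast; ring, zpow_natCast]
    push_cast
    ring
  rw [hT]
  trans ∑ k ∈ range (n + 1), (n.choose k : ℚ) ^ (2 * m + 4) +
    (2 * m + 3) * (harmonic n * ∑ k ∈ range (n + 1), (n.choose k : ℚ) ^ (2 * m + 4) * (n - 2 * k) -
      ∑ k ∈ range (n + 1), (n.choose k : ℚ) ^ (2 * m + 4) * (n - 2 * k) * harmonic (n - k)) +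
    ∑ k ∈ range (n + 1), (n.choose k : ℚ) ^ (2 * m + 4) * (n - 2 * k) * harmonic k
  · simp only [mul_sum, ← sum_sub_distrib, ← sum_add_distrib]
    exact sum_congr rfl fun k _ => by ring
  · rw [h1, h2]
    simp only [mul_zero, zero_sub, neg_neg, mul_sum, ← sum_add_distrib]
    exact sum_congr rfl fun k _ => by ring

/-- Both sides of the series identity are differentiated at `x = 0`. -/
lemma harmonicT_eq_baileyChain (m n : ℕ) :
    harmonicT (2 * (m : ℤ) + 4) n = (-1) ^ n * baileyChain (-(n : ℚ)) m n := by
  set g : ℚ → ℚ := fun x => risingCoeff (x - n) n * baileyChain (x - n) m n with hg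
  have hgc : Continuous g :=
    ((continuous_risingCoeff n).mul (continuous_baileyChain m n)).comp
      (continuous_id.sub continuous_const)
  have hg0 : g 0 = (-1) ^ n * baileyChain (-(n : ℚ)) m n := by
    simp [hg, risingCoeff_neg_natCast]
  -- The right-hand side `x * g x` of the series identity has derivative `g 0` at `0`.
  have hd : HasDerivAt (fun x => x * g x) (g 0) 0 := by
    rw [hasDerivAt_iff_tendsto_slope]
    refine (hgc.continuousAt.tendsto.mono_left nhdsWithin_le_nhds).congr' ?_
    filter_upwards [self_mem_nhdsWithin] with x hx
    have : x ≠ 0 := hx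
    simp [slope_def_field, this]
  rw [← hg0]
  refine (hasDerivAt_sum_wellPoised m n).unique (hd.congr_of_eventuallyEq ?_)
  filter_upwards [Ioo_mem_nhds (show (-1 : ℚ) < 0 by norm_num) one_pos] with x hx
  rcases eq_or_ne x 0 with rfl | hx0
  · have h0 := neg_eq_zero.mpr (sum_choose_pow_mul_sub (2 * m + 4) n)
    rw [← sum_neg_distrib] at h0
    rw [zero_mul]
    refine Eq.trans ?_ h0
    refine sum_congr rfl fun r hr => ?_
    have hr : r ≤ n := Nat.lt_succ_iff.mp (mem_range.mp hr)
    have hsp : (-1 : ℚ) ^ r * ((-1 : ℚ) ^ r) ^ (2 * m + 3) = 1 := by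
      rw [← pow_succ', ← pow_mul, show r * (2 * m + 3 + 1) = 2 * (r * (m + 2)) by ring, pow_mul]
      simp
    rw [zero_sub, risingCoeff_neg_natCast hr, add_zero, risingCoeff_one, mul_pow,
      show 2 * m + 4 = 2 * m + 3 + 1 by ring, pow_succ (n.choose r : ℚ)]
    linear_combination -(n - 2 * r) * (n.choose r : ℚ) ^ (2 * m + 3) * n.choose r * hsp
  · refine sum_wellPoised m n x fun k _ h => hx0 ?_
    -- An integer strictly between `-1` and `1` vanishes.
    have hxz : x = (((n : ℤ) - k : ℤ) : ℚ) := by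
      push_cast
      linarith
    rw [hxz] at hx ⊢
    have h1 : (-1 : ℤ) < n - k := by exact_mod_cast hx.1
    have h2 : ((n : ℤ) - k : ℤ) < 1 := by exact_mod_cast hx.2
    rw [show ((n : ℤ) - k : ℤ) = 0 by omega, Int.cast_zero]

end Derivative

/-! ### Sums over chains -/

section Chains

lemma baileyChain_neg_natCast_zero (n i : ℕ) :
    baileyChain (-(n : ℚ)) 0 i = (n + i).choose n := by
  rw [baileyChain_zero, sub_neg_eq_add, risingCoeff_one_add_natCast]

lemma baileyChain_neg_natCast_succ (m : ℕ) {n i : ℕ} (hi : i ≤ n) :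
    baileyChain (-(n : ℚ)) (m + 1) i = ∑ j ∈ range (i + 1),
      (n.choose j : ℚ) ^ 2 * (n + (i - j)).choose n * baileyChain (-(n : ℚ)) m j := by
  rw [baileyChain_succ, baileyStep]
  refine sum_congr rfl fun j hj => ?_
  have hj : j ≤ i := Nat.lt_succ_iff.mp (mem_range.mp hj)
  have hs : ((-1 : ℚ) ^ j) ^ 2 = 1 := by rw [← pow_mul, mul_comm, pow_mul]; simp
  rw [sub_neg_eq_add, risingCoeff_one_add_natCast, risingCoeff_neg_natCast (hj.trans hi), mul_pow,
    hs, one_mul]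

/-- The sum over all chains `i_1 ≤ ⋯ ≤ i_m ≤ l` with an arbitrary last entry `l`. The chain
condition is an indicator in each factor, so that splitting off the last entry is a splitting of
the product. -/
lemma sum_chain_eq_baileyChain (m n : ℕ) (l : Fin (n + 1)) :
    ∑ i : Fin (m + 1) → Fin (n + 1), (if i (Fin.last m) = l then
        ((n + (i 0 : ℕ)).choose n : ℚ) * ∏ r : Fin m, (if i r.castSucc ≤ i r.succ then
          (n.choose (i r.castSucc : ℕ) : ℚ) ^ 2 *
            ((n + ((i r.succ : ℕ) - (i r.castSucc : ℕ))).choose n : ℚ) else 0) else 0) =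
      baileyChain (-(n : ℚ)) m l := by
  induction m generalizing l with
  | zero =>
    rw [← (Equiv.funUnique (Fin 1) (Fin (n + 1))).symm.sum_comp]
    simp [baileyChain_neg_natCast_zero]
  | succ m ih =>
    rw [baileyChain_neg_natCast_succ m (Nat.lt_succ_iff.mp l.2),
      ← (Fin.snocEquiv fun _ : Fin (m + 1 + 1) => Fin (n + 1)).sum_comp, Fintype.sum_prod_type]
    have hrange : ∑ j ∈ range ((l : ℕ) + 1),
        (n.choose j : ℚ) ^ 2 * (n + (l - j)).choose n * baileyChain (-(n : ℚ)) m j =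
        ∑ j : Fin (n + 1), if j ≤ l then
          (n.choose j : ℚ) ^ 2 * (n + (l - j)).choose n * baileyChain (-(n : ℚ)) m j else 0 := by
      simp only [← Fin.val_fin_le]
      rw [Fin.sum_univ_eq_sum_range (fun j => if j ≤ (l : ℕ) then
          (n.choose j : ℚ) ^ 2 * (n + (l - j)).choose n * baileyChain (-(n : ℚ)) m j else 0),
        ← sum_filter]
      refine sum_congr ?_ fun _ _ => rfl
      ext j
      have := l.2
      simp only [mem_range, mem_filter]
      omega
    -- Only tuples ending in `l` contribute; the sum over their initial parts is then grouped by
    -- the last entry `j` of the initial part.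
    rw [hrange, sum_eq_single l]
    · simp_rw [← ih, mul_sum, ite_sum_zero]
      rw [sum_comm]
      refine sum_congr rfl fun f _ => ?_
      rw [sum_eq_single (f (Fin.last m))]
      · simp only [Fin.snocEquiv_apply, Fin.snoc_last, if_true, Fin.prod_univ_castSucc,
          Fin.succ_castSucc, Fin.snoc_castSucc, Fin.succ_last]
        have h0 : (Fin.snoc f l : Fin (m + 1 + 1) → Fin (n + 1)) 0 = f 0 :=
          Fin.snoc_castSucc (α := fun _ => Fin (n + 1)) l f 0
        rw [h0]
        split_ifs <;> ring
      · intro j _ hj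
        simp [hj.symm]
      · simp
    · intro b _ hb
      simp [Fin.snocEquiv_apply, hb]
    · simp

end Chains

lemma sum_chainsTo (m n : ℕ) :
    ∑ i ∈ chainsTo m n, ((n + (i 0 : ℕ)).choose n : ℚ) *
        ∏ r : Fin m, ((n.choose (i r.castSucc : ℕ) : ℚ) ^ 2 *
          ((n + ((i r.succ : ℕ) - (i r.castSucc : ℕ))).choose n : ℚ)) =
      baileyChain (-(n : ℚ)) m n := by
  rw [chainsTo, sum_filter]
  refine Eq.trans (sum_congr rfl fun i _ => ?_) (sum_chain_eq_baileyChain m n (Fin.last n))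
  by_cases hc : ∀ r : Fin m, i r.castSucc ≤ i r.succ
  · simp [hc]
  · rw [if_neg fun h => hc h.1]
    push Not at hc
    obtain ⟨r, hr⟩ := hc
    rw [prod_eq_zero (mem_univ r) (if_neg (not_le.mpr hr)), mul_zero, ite_self]

theorem mainTheorem3 :
    (∀ m n : ℕ,
      harmonicT (2 * (m : ℤ) + 4) n =
        (-1 : ℚ) ^ n * ∑ i ∈ chainsTo m n,
          ((n + (i 0 : ℕ)).choose n : ℚ) *
            ∏ r : Fin m,
              ((n.choose (i r.castSucc : ℕ) : ℚ) ^ 2 *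
                ((n + ((i r.succ : ℕ) - (i r.castSucc : ℕ))).choose n : ℚ))) ∧
    (∀ n : ℕ,
      harmonicT 8 n =
        (-1 : ℚ) ^ n * ∑ i ∈ Finset.range (n + 1),
          (n.choose i : ℚ) ^ 2 * ((2 * n - i).choose n : ℚ) *
            ∑ j ∈ Finset.range (i + 1),
              (n.choose j : ℚ) ^ 2 * ((n + j).choose n : ℚ) * ((n + (i - j)).choose n : ℚ)) ∧
    (∀ n : ℕ,
      harmonicT 10 n =
        (-1 : ℚ) ^ n * ∑ i ∈ Finset.range (n + 1),
          (n.choose i : ℚ) ^ 2 * ((2 * n - i).choose n : ℚ) *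
            ∑ j ∈ Finset.range (i + 1),
              (n.choose j : ℚ) ^ 2 * ((n + (i - j)).choose n : ℚ) *
                ∑ t ∈ Finset.range (j + 1),
                  (n.choose t : ℚ) ^ 2 * ((n + t).choose n : ℚ) *
                    ((n + (j - t)).choose n : ℚ)) := by
  have hlast {n i : ℕ} (hi : i ∈ range (n + 1)) : n + (n - i) = 2 * n - i := by
    have := mem_range.mp hi
    omega
  have hle {n i j : ℕ} (hi : i ≤ n) (hj : j ∈ range (i + 1)) : j ≤ n := by
    have := mem_range.mp hj
    omega
  have hone {n i : ℕ} (hi : i ≤ n) : baileyChain (-(n : ℚ)) 1 i = ∑ j ∈ range (i + 1),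
      (n.choose j : ℚ) ^ 2 * ((n + j).choose n : ℚ) * ((n + (i - j)).choose n : ℚ) := by
    rw [baileyChain_neg_natCast_succ 0 hi]
    refine sum_congr rfl fun j _ => ?_
    rw [baileyChain_neg_natCast_zero]
    ring
  refine ⟨fun m n => ?_, fun n => ?_, fun n => ?_⟩
  · rw [sum_chainsTo, harmonicT_eq_baileyChain]
  · rw [show (8 : ℤ) = 2 * ((2 : ℕ) : ℤ) + 4 by norm_num, harmonicT_eq_baileyChain,
      baileyChain_neg_natCast_succ 1 le_rfl]
    congr 1
    refine sum_congr rfl fun i hi => ?_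
    rw [hlast hi, hone (hle le_rfl hi)]
  · rw [show (10 : ℤ) = 2 * ((3 : ℕ) : ℤ) + 4 by norm_num, harmonicT_eq_baileyChain,
      baileyChain_neg_natCast_succ 2 le_rfl]
    congr 1
    refine sum_congr rfl fun i hi => ?_
    rw [hlast hi, baileyChain_neg_natCast_succ 1 (hle le_rfl hi)]
    congr 1
    refine sum_congr rfl fun j hj => ?_
    rw [hone (hle (hle le_rfl hi) hj)]
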